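/- A subset $S$ of a metric space embeds into $\ell_1^d$ with distortion $D$ if there are a map $F:S\to\ell_1^d$ and $s>0$ with $s\,\mathrm{dist}(x,y)\le\|F(x)-F(y)\|_1\le D\,s\,\mathrm{dist}(x,y)$ for all $x,y\in S$. For integers $k\ge 2$, $n\ge 0$, the recursive cycle graph $G_{k,n}$, with edges oriented from left to right and vertex labels in $\{0,1\}^{k^n}$, is defined as follows. $G_{k,0}$ is a single edge, with left endpoint labeled $0$ and right endpoint labeled $1$. $G_{k,n+1}$ arises from $G_{k,n}$ by replacing each edge by a cycle of length $2k$ that consists of two paths of length $k$ (``top'' and ``bottom'') from the left to the right endpoint of the edge, all new edges being oriented from left to right. Vertices of $G_{k,n}$ keep their labels in $G_{k,n+1}$, with each coordinate duplicated $k$ times. The label of a new vertex on the cycle that replaces an edge $e$ agrees with the duplicated labels of the endpoints of $e$ wherever these agree; the $k$ coordinates in which they differ are set to $0^{k-i}1^{i}$ for the $i$th vertex of the top path and to $1^{i}0^{k-i}$ for the $i$th vertex of the bottom path ($0<i<k$). Let $P_{k,n}\subset\ell_1^{k^n}$ be the set of all labels of vertices of $G_{k,n}$. **Theorem 1.** Let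 $L_1=L_1([0,1])$. (1) There is an absolute constant $c>0$ such that for every large enough integer $N$ there is an $N$-point subset of $L_1$ with the following property: for every $D>1$ and every $d$, if it embeds into $\ell_1^d$ with distortion $D$, then $\max\{d,2\}\ge N^{c/D^2}$ (that is, $d\ge N^{c/D^2}$ if $d\ge 2$, and $N^{c/D^2}\le 2$ if $d=1$). The same bound, with $N=|P_{2,n}|$, holds for the point set $P_{2,n}$, for every $n\ge 1$. (2) There is an absolute constant $C>0$ such that for every $0<\varepsilon<1$ and every integer $N$ large enough (depending on $\varepsilon$) there is an $N$-point subset of $L_1$ such that every embedding of it into $\ell_1^d$ with distortion $1+\varepsilon$ has $d\ge N^{1-C/\log(1/\varepsilon)}$. Moreover, for every $0<\varepsilon<1$ there is $k\ge 2$ such that for all large enough $n$ the same bound, with $N=|P_{k,n}|$, holds for the point set $P_{k,n}$. -/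

import Mathlib

open MeasureTheory

/-- The Banach space `L₁ = L₁([0,1])` of (classes of) Lebesgue integrable real functions. -/
abbrev L1Space : Type := Lp ℝ 1 (volume.restrict (Set.Icc (0 : ℝ) 1))

/-- The space `ℓ₁^ι`, i.e. `ℝ^ι` with the norm `‖x‖ = ∑ i, |x i|`. -/
abbrev Ell1 (ι : Type) [Fintype ι] : Type := PiLp 1 (fun _ : ι => ℝ)

/-- There is an embedding of the subset `S` of the metric space `X` into the metric space `Y`
with distortion at most `D`: up to a scaling by `s > 0`, no distance between points of `S` is
contracted, and none is expanded by a factor of more than `D`. -/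
def EmbedsWithDistortion {X : Type*} [MetricSpace X] (S : Set X) (Y : Type*) [MetricSpace Y]
    (D : ℝ) : Prop :=
  ∃ F : S → Y, ∃ s : ℝ, 0 < s ∧ ∀ x y : S,
    s * dist x y ≤ dist (F x) (F y) ∧ dist (F x) (F y) ≤ D * (s * dist x y)

namespace RecursiveCycle

/-- Edges of `G_{k,n}`, indexed by `[2k]^n`: the entry `x 0` is the position in the top layer, the
last entry the position in the bottom layer. (`G_{k,0}` is a single edge.) -/
abbrev Edge (k n : ℕ) : Type := Fin n → Fin (2 * k)

/-- The vertices of the recursive cycle graph `G_{k,n}`. `G_{k,0}` is a single edge from a left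
to a right vertex; `G_{k,n+1}` has the vertices of `G_{k,n}` and, for every edge `e` of `G_{k,n}`,
the `k - 1` inner vertices of the top path (`top = true`) and of the bottom path (`top = false`) of
the `2k`-cycle that replaces `e`. `inner e top i` is the vertex at position `i + 1` of its path,
counted from the left endpoint of `e`, which has position `0`; the right endpoint has
position `k`. -/
inductive Vertex (k : ℕ) : ℕ → Type
  | left : Vertex k 0
  | right : Vertex k 0
  | old {n : ℕ} (v : Vertex k n) : Vertex k (n + 1)
  | inner {n : ℕ} (e : Edge k n) (top : Bool) (i : Fin (k - 1)) : Vertex k (n + 1)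

/-- The vertex at position `i` on the top or bottom path of the cycle that replaces the edge `e`
with left endpoint `u` and right endpoint `v`. -/
def pathVertex {k n : ℕ} (e : Edge k n) (u v : Vertex k n) (top : Bool) (i : ℕ) :
    Vertex k (n + 1) :=
  if i = 0 then .old u
  else if h : i - 1 < k - 1 then .inner e top ⟨i - 1, h⟩
  else .old v

/-- The (left, right) endpoints of an edge of `G_{k,n}`. In each cycle, the edges
`0, …, k-1` run along the top path from left to right, and the edges `k, …, 2k-1` go back along
the bottom path from right to left; every edge is oriented from left to right. -/
def endpoints {k : ℕ} : {n : ℕ} → Edge k n → Vertex k n × Vertex k n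
  | 0, _ => (.left, .right)
  | n + 1, x =>
    let e : Edge k n := Fin.init x
    let b : ℕ := x (Fin.last n)
    let p := endpoints e
    if b < k then
      (pathVertex e p.1 p.2 true b, pathVertex e p.1 p.2 true (b + 1))
    else
      (pathVertex e p.1 p.2 false (2 * k - b - 1), pathVertex e p.1 p.2 false (2 * k - b))

/-- The coordinate `j` of the label in `{0,1}^k` of the vertex at position `i` of a `2k`-cycle:
`k - i` zeros followed by `i` ones on the top path, `i` ones followed by `k - i` zeros on the
bottom path. -/
def cycleLabel (k : ℕ) (top : Bool) (i : ℕ) (j : Fin k) : ℝ :=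
  if top then (if (j : ℕ) < k - i then 0 else 1) else (if (j : ℕ) < i then 1 else 0)

/-- The label in `{0,1}^(k^n)` of a vertex of `G_{k,n}`, with the `k^n` coordinates indexed by
`[k]^n`. For a vertex of `G_{k,n}`, its coordinates are duplicated `k` times in `G_{k,n+1}`; for an
inner vertex of the cycle that replaces `e`, those blocks of `k` coordinates in which the endpoints
of `e` differ are replaced by the label of the cycle. -/
noncomputable def label {k : ℕ} : {n : ℕ} → Vertex k n → (Fin n → Fin k) → ℝ
  | 0, .left, _ => 0
  | 0, .right, _ => 1
  | _ + 1, .old v, c => label v (Fin.init c)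
  | n + 1, .inner e top i, c =>
    let u := label (endpoints e).1 (Fin.init c)
    let v := label (endpoints e).2 (Fin.init c)
    if u = v then u else cycleLabel k top (i + 1) (c (Fin.last n))

/-- The point set `P_{k,n}` in `ℓ₁^(k^n)`: the labels of all vertices of `G_{k,n}`. -/
noncomputable def points (k n : ℕ) : Set (Ell1 (Fin n → Fin k)) :=
  Set.range fun v : Vertex k n => WithLp.toLp 1 (label v)

end RecursiveCycle

/-!
The lower bounds come from an entropy argument on the recursive cycle graph `G_{k,n}`. Let `F` embed
`P_{k,n}` into `ℓ₁^d`. Every edge `(u, v)` of `G_{k,n}` determines the vector `F(v) - F(u)`, whose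
norm is at most `D s`; scaled by `1 / (D s)`, its positive and negative parts form a probability
vector on the `2d` signed coordinates and one further symbol, which takes up the missing mass. So a
random edge, together with a random symbol drawn from its vector, has mutual information at most
`log (2d + 1)` between edge and symbol.

On the other hand the information is at least `n κ`, where `κ` is a lower bound for what a symbol
reveals about the position of an edge in one cycle. This is because the vectors of the `2k` edges
that replace an edge `e` average to the vector of `e` for the embedding of `G_{k,n}` that is
obtained by restricting an embedding of `G_{k,n+1}` to the old vertices
(`RecursiveCycle.sum_sub_endpoints_snoc`), so that one can induct on `n`
(`RecursiveCycle.entropy_mixture_edges`). In place of mutual information, the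
proof compares the entropy of an average of vectors with the average of their entropies.

All that is used about one cycle is that its labels form an isometric `2k`-cycle, so that any two
steps around it that are not antipodal lie on a common geodesic and cannot nearly cancel
(`isNearlyIsometricCycle_of_walk`).

* For `k = 2` and any `D`, the vectors of the two edges at the left endpoint of the cycle are at
  distance at least `2 / D`, and Pinsker's inequality gives `κ = 1 / (8 D²)`
  (`entropy_gain_four_cycle`).
* For `D = 1 + ε` and `k⁴ ε ≤ 1`, the vectors of edges that are not antipodal are nearly disjointly
  supported: opposite signs do not overlap as the steps do not cancel, and equal signs do not
  overlap as the steps sum to zero (`sum_min_weight_le`). So a symbol reveals the edge up to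
  antipodes, and `κ = log (2k) - 9` (`entropy_gain_two_mul_cycle`).

As `G_{k,n}` has at most `2 (2k)^n` vertices, comparing `n κ` with `log (2d + 1)` gives the bounds
for `P_{k,n}`. For arbitrary `N`, a set `P_{k,n}` with `n` as large as possible is embedded
isometrically into `L₁` and enlarged to `N` points.
-/

namespace RecursiveCycle

/-! ### Labels of the recursive cycle graph -/

variable {k n : ℕ}

/-- The `ℓ₁` distance between the labels of two vertices. -/
noncomputable def labelDist (u v : Vertex k n) : ℝ :=
  ∑ c, |label u c - label v c|

theorem cycleLabel_zero (top : Bool) (j : Fin k) : cycleLabel k top 0 j = 0 := by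
  cases top <;> simp [cycleLabel]

theorem cycleLabel_self (top : Bool) (j : Fin k) : cycleLabel k top k j = 1 := by
  cases top <;> simp [cycleLabel]

/-- The rule for the labels of inner vertices holds at all positions `0 ≤ i ≤ k` of a path, its
endpoints included. Here `c₀` is the coordinate in which the labels of the endpoints of `e`
differ. -/
theorem label_pathVertex {e : Edge k n} {c₀ : Fin n → Fin k}
    (h0 : label (endpoints e).1 c₀ = 0) (h1 : label (endpoints e).2 c₀ = 1)
    (h : ∀ c, c ≠ c₀ → label (endpoints e).1 c = label (endpoints e).2 c)
    (top : Bool) {i : ℕ} (hi : i ≤ k) (c : Fin (n + 1) → Fin k) :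
    label (pathVertex e (endpoints e).1 (endpoints e).2 top i) c =
      if Fin.init c = c₀ then cycleLabel k top i (c (Fin.last n))
      else label (endpoints e).1 (Fin.init c) := by
  have heq : Fin.init c ≠ c₀ →
      label (endpoints e).1 (Fin.init c) = label (endpoints e).2 (Fin.init c) := h _
  unfold pathVertex
  by_cases hi0 : i = 0
  · subst hi0
    by_cases hc : Fin.init c = c₀ <;> simp [label, hc, h0, cycleLabel_zero]
  by_cases hi1 : i - 1 < k - 1
  · by_cases hc : Fin.init c = c₀
    · have hi' : i - 1 + 1 = i := by omega
      simp [label, hc, h0, h1, hi0, hi1, hi']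
    · simp [label, hc, hi0, hi1, heq hc]
  · obtain rfl : i = k := by omega
    by_cases hc : Fin.init c = c₀
    · simp [label, hc, h1, hi0, cycleLabel_self]
    · simp [label, hc, hi0, heq hc]

theorem exists_cycleLabel_step (top : Bool) {i : ℕ} (hi : i < k) :
    ∃ j₀ : Fin k, cycleLabel k top i j₀ = 0 ∧ cycleLabel k top (i + 1) j₀ = 1 ∧
      ∀ j, j ≠ j₀ → cycleLabel k top i j = cycleLabel k top (i + 1) j := by
  cases top
  · refine ⟨⟨i, hi⟩, by simp [cycleLabel], by simp [cycleLabel], fun j hj => ?_⟩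
    have : (j : ℕ) ≠ i := fun h => hj (Fin.ext h)
    have : (j : ℕ) < i ↔ (j : ℕ) < i + 1 := by omega
    simp [cycleLabel, this]
  · refine ⟨⟨k - (i + 1), by omega⟩, ?_, ?_, fun j hj => ?_⟩
    · simp only [cycleLabel, if_true]; rw [if_pos (by omega)]
    · simp [cycleLabel]
    have : (j : ℕ) ≠ k - (i + 1) := fun h => hj (Fin.ext h)
    have : (j : ℕ) < k - i ↔ (j : ℕ) < k - (i + 1) := by omega
    simp [cycleLabel, this]

/-- The endpoints of every edge are path vertices at consecutive positions. -/
theorem exists_endpoints_eq_pathVertex (x : Edge k (n + 1)) :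
    ∃ top : Bool, ∃ i < k, endpoints x =
      (pathVertex (Fin.init x) (endpoints (Fin.init x)).1 (endpoints (Fin.init x)).2 top i,
       pathVertex (Fin.init x) (endpoints (Fin.init x)).1 (endpoints (Fin.init x)).2 top
        (i + 1)) := by
  have hx := (x (Fin.last n)).isLt
  by_cases hb : (x (Fin.last n) : ℕ) < k
  · exact ⟨true, x (Fin.last n), hb, by simp [endpoints, hb]⟩
  · refine ⟨false, 2 * k - x (Fin.last n) - 1, by omega, ?_⟩
    rw [Nat.sub_add_cancel (by omega)]
    simp [endpoints, hb]

theorem exists_label_endpoints : ∀ {n : ℕ} (e : Edge k n), ∃ c₀ : Fin n → Fin k,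
    label (endpoints e).1 c₀ = 0 ∧ label (endpoints e).2 c₀ = 1 ∧
      ∀ c, c ≠ c₀ → label (endpoints e).1 c = label (endpoints e).2 c
  | 0, e => ⟨Fin.elim0, by simp [endpoints, label], by simp [endpoints, label],
      fun c hc => absurd (Subsingleton.elim _ _) hc⟩
  | n + 1, x => by
    obtain ⟨c₀, h0, h1, h⟩ := exists_label_endpoints (Fin.init x)
    obtain ⟨top, i, hi, hx⟩ := exists_endpoints_eq_pathVertex x
    obtain ⟨j₀, g0, g1, g⟩ := exists_cycleLabel_step top hi
    rw [hx]
    refine ⟨Fin.snoc c₀ j₀, ?_, ?_, fun c hc => ?_⟩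
    · rw [label_pathVertex h0 h1 h top hi.le]; simp [g0]
    · rw [label_pathVertex h0 h1 h top hi]; simp [g1]
    · simp only [label_pathVertex h0 h1 h top hi.le, label_pathVertex h0 h1 h top hi]
      split_ifs with hc'
      · refine g _ fun hl => hc ?_
        rw [← hc', ← hl, Fin.snoc_init_self]
      · rfl

theorem labelDist_endpoints (e : Edge k n) :
    labelDist (endpoints e).1 (endpoints e).2 = 1 := by
  obtain ⟨c₀, h0, h1, h⟩ := exists_label_endpoints e
  rw [labelDist, Finset.sum_eq_single c₀]
  · simp [h0, h1]
  · intro c _ hc; simp [h c hc]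
  · simp

theorem labelDist_comm (u v : Vertex k n) : labelDist u v = labelDist v u := by
  simp [labelDist, abs_sub_comm]

theorem sum_snoc {α M : Type*} [Fintype α] [AddCommMonoid M] (g : (Fin (n + 1) → α) → M) :
    ∑ x, g x = ∑ e : Fin n → α, ∑ b : α, g (Fin.snoc e b) := by
  rw [← (Fin.snocEquiv fun _ => α).sum_comp, Fintype.sum_prod_type_right]
  rfl

theorem labelDist_old (u v : Vertex k n) :
    labelDist (.old u) (.old v) = k * labelDist u v := by
  simp [labelDist, sum_snoc, label, Finset.mul_sum]

/-- The closed walk of length `2k` around the cycle that replaces `e`: along the top path to the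
right endpoint at time `k`, and back along the bottom path. -/
def cycleVertex (e : Edge k n) (t : ℕ) : Vertex k (n + 1) :=
  if t ≤ k then pathVertex e (endpoints e).1 (endpoints e).2 true t
  else pathVertex e (endpoints e).1 (endpoints e).2 false (2 * k - t)

theorem cycleVertex_zero (e : Edge k n) : cycleVertex e 0 = .old (endpoints e).1 := by
  simp [cycleVertex, pathVertex]

theorem cycleVertex_two_mul (hk : 0 < k) (e : Edge k n) :
    cycleVertex e (2 * k) = .old (endpoints e).1 := by
  rw [cycleVertex, if_neg (by omega)]
  simp [pathVertex]

theorem cycleVertex_of_ge (hk : 0 < k) (e : Edge k n) {t : ℕ} (ht : k ≤ t) :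
    cycleVertex e t = pathVertex e (endpoints e).1 (endpoints e).2 false (2 * k - t) := by
  rcases ht.eq_or_lt with rfl | ht
  · have h1 : 2 * k - k = k := by omega
    rw [cycleVertex, if_pos le_rfl, h1]
    simp [pathVertex, hk.ne']
  · rw [cycleVertex, if_neg (by omega)]

theorem cycleVertex_self (hk : 0 < k) (e : Edge k n) :
    cycleVertex e k = .old (endpoints e).2 := by
  rw [cycleVertex, if_pos le_rfl]
  simp [pathVertex, hk.ne']

/-- The orientation of the edges agrees with the direction of the closed walk `cycleVertex` on the
top path, and is opposite to it on the bottom path. -/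
theorem endpoints_snoc (hk : 0 < k) (e : Edge k n) (b : Fin (2 * k)) :
    endpoints (Fin.snoc e b : Edge k (n + 1)) =
      if (b : ℕ) < k then (cycleVertex e b, cycleVertex e (b + 1))
      else (cycleVertex e (b + 1), cycleVertex e b) := by
  have hb := b.isLt
  simp only [endpoints, Fin.init_snoc, Fin.snoc_last]
  split_ifs with h
  · rw [cycleVertex, cycleVertex, if_pos h.le, if_pos (by omega)]
  · rw [cycleVertex_of_ge hk e (by omega), cycleVertex_of_ge hk e (by omega), Nat.sub_sub]

theorem labelDist_cycleVertex_succ (hk : 0 < k) (e : Edge k n) {t : ℕ} (ht : t < 2 * k) :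
    labelDist (cycleVertex e t) (cycleVertex e (t + 1)) = 1 := by
  have h := labelDist_endpoints (Fin.snoc e ⟨t, ht⟩ : Edge k (n + 1))
  rw [endpoints_snoc hk] at h
  by_cases h' : t < k
  · simpa [h'] using h
  · rw [labelDist_comm]; simpa [h'] using h

/-- Antipodal vertices of the cycle differ in all `k` new coordinates. -/
theorem labelDist_cycleVertex_add (hk : 0 < k) (e : Edge k n) {t : ℕ} (ht : t ≤ k) :
    labelDist (cycleVertex e t) (cycleVertex e (t + k)) = k := by
  obtain ⟨c₀, h0, h1, h⟩ := exists_label_endpoints e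
  rw [cycleVertex_of_ge hk e (t := t + k) (by omega), cycleVertex, if_pos ht, labelDist, sum_snoc,
    Finset.sum_eq_single c₀]
  · simp only [label_pathVertex h0 h1 h true ht,
      label_pathVertex h0 h1 h false (show 2 * k - (t + k) ≤ k by omega), Fin.init_snoc,
      Fin.snoc_last, if_true]
    have : ∀ b : Fin k,
        |cycleLabel k true t b - cycleLabel k false (2 * k - (t + k)) b| = 1 := by
      intro b
      have : 2 * k - (t + k) = k - t := by omega
      rw [this]
      by_cases hb : (b : ℕ) < k - t <;> simp [cycleLabel, hb]
    simp [this]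
  · intro c _ hc
    simp [label_pathVertex h0 h1 h true ht,
      label_pathVertex h0 h1 h false (show 2 * k - (t + k) ≤ k by omega), hc]
  · simp

/-! ### Counting vertices -/

/-- The vertices of `G_{k,n+1}` are the old ones and the inner vertices of the new paths. -/
def vertexSuccEquiv (k n : ℕ) :
    Vertex k (n + 1) ≃ Vertex k n ⊕ (Edge k n × Bool × Fin (k - 1)) where
  toFun
    | .old v => .inl v
    | .inner e top i => .inr (e, top, i)
  invFun
    | .inl v => .old v
    | .inr (e, top, i) => .inner e top i
  left_inv v := by cases v <;> rfl
  right_inv v := by rcases v with v | ⟨e, top, i⟩ <;> rfl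

/-- The two vertices of the single edge `G_{k,0}`. -/
def vertexZeroEquiv (k : ℕ) : Vertex k 0 ≃ Bool where
  toFun
    | .left => false
    | .right => true
  invFun b := if b then .right else .left
  left_inv v := by cases v <;> rfl
  right_inv b := by cases b <;> rfl

instance finite_vertex (k : ℕ) : ∀ n, Finite (Vertex k n)
  | 0 => Finite.of_equiv _ (vertexZeroEquiv k).symm
  | n + 1 => by
    have := finite_vertex k n
    exact Finite.of_equiv _ (vertexSuccEquiv k n).symm

theorem card_vertex_le (hk : 1 ≤ k) : ∀ n, Nat.card (Vertex k n) ≤ 2 * (2 * k) ^ n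
  | 0 => by simp [Nat.card_congr (vertexZeroEquiv k)]
  | n + 1 => by
    have ih := card_vertex_le hk n
    rw [Nat.card_congr (vertexSuccEquiv k n), Nat.card_sum]
    simp only [Nat.card_eq_fintype_card, Fintype.card_prod, Fintype.card_fun, Fintype.card_fin,
      Fintype.card_bool] at ih ⊢
    obtain ⟨m, rfl⟩ : ∃ m, k = m + 1 := ⟨k - 1, by omega⟩
    rw [pow_succ, Nat.add_sub_cancel]
    nlinarith [Nat.zero_le ((2 * (m + 1)) ^ n * m)]

theorem points_finite (k n : ℕ) : (points k n).Finite := Set.finite_range _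

theorem ncard_points_le (hk : 1 ≤ k) (n : ℕ) : (points k n).ncard ≤ 2 * (2 * k) ^ n := by
  refine le_trans ?_ (card_vertex_le hk n)
  rw [points, ← Set.image_univ, ← Set.ncard_univ]
  exact Set.ncard_image_le

end RecursiveCycle

/-! ### Entropy -/

section Entropy

open Real

variable {α β : Type*} [Fintype α] [Fintype β]

/-- The Shannon entropy (in nats) of a probability vector. -/
noncomputable def entropy (p : α → ℝ) : ℝ := ∑ a, negMulLog (p a)

/-- The Kullback–Leibler divergence of the probability vector `p` from `q`. It has its usual
meaning only if `p` vanishes wherever `q` does. -/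
noncomputable def klSum (p q : α → ℝ) : ℝ := ∑ a, p a * (log (p a) - log (q a))

/-- The average of a finite family of vectors. -/
noncomputable def mixture (p : β → α → ℝ) (a : α) : ℝ := (Fintype.card β : ℝ)⁻¹ * ∑ b, p b a

theorem mixture_mem_stdSimplex [Nonempty β] {p : β → α → ℝ} (hp : ∀ b, p b ∈ stdSimplex ℝ α) :
    mixture p ∈ stdSimplex ℝ α := by
  refine ⟨fun a => mul_nonneg (by positivity) (Finset.sum_nonneg fun b _ => (hp b).1 a), ?_⟩
  simp only [mixture]
  rw [← Finset.mul_sum, Finset.sum_comm, Finset.sum_congr rfl fun b _ => (hp b).2]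
  simp

theorem eq_zero_of_mixture_eq_zero [Nonempty β] {p : β → α → ℝ}
    (hp : ∀ b, p b ∈ stdSimplex ℝ α) {a : α} (h : mixture p a = 0) (b : β) : p b a = 0 := by
  rw [mixture, mul_eq_zero] at h
  have h := h.resolve_left (by simp)
  rw [Finset.sum_eq_zero_iff_of_nonneg fun b _ => (hp b).1 a] at h
  exact h b (Finset.mem_univ b)

theorem entropy_mixture (p : β → α → ℝ) :
    entropy (mixture p) = (Fintype.card β : ℝ)⁻¹ * ∑ b, entropy (p b) +
      (Fintype.card β : ℝ)⁻¹ * ∑ b, klSum (p b) (mixture p) := by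
  rw [← mul_add, ← Finset.sum_add_distrib]
  have h1 : ∀ b, entropy (p b) + klSum (p b) (mixture p) =
      ∑ a, -(p b a * log (mixture p a)) := fun b => by
    rw [entropy, klSum, ← Finset.sum_add_distrib]
    exact Finset.sum_congr rfl fun a _ => by rw [negMulLog]; ring
  simp only [h1]
  rw [Finset.sum_comm, Finset.mul_sum, entropy]
  refine Finset.sum_congr rfl fun a _ => ?_
  rw [Finset.sum_neg_distrib, ← Finset.sum_mul, negMulLog]
  conv_lhs => rw [mixture]
  simp only [mixture]
  ring

theorem sq_sqrt_sub_sqrt_le {p q : ℝ} (hp : 0 ≤ p) (hq : 0 ≤ q) (h : q = 0 → p = 0) :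
    (√p - √q) ^ 2 ≤ p * (log p - log q) - p + q := by
  rcases hp.eq_or_lt with rfl | hp
  · simp [sq_sqrt hq]
  have hq : 0 < q := hq.lt_of_ne fun h' => hp.ne' (h h'.symm)
  have hp' := sqrt_pos.2 hp
  have hq' := sqrt_pos.2 hq
  have key : log (√q / √p) ≤ √q / √p - 1 := log_le_sub_one_of_pos (by positivity)
  rw [log_div hq'.ne' hp'.ne', log_sqrt hp.le, log_sqrt hq.le] at key
  have h1 : p * (√q / √p) = √p * √q := by
    rw [← mul_div_assoc, div_eq_iff hp'.ne']
    nth_rewrite 1 [← mul_self_sqrt hp.le]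
    ring
  have h2 := mul_le_mul_of_nonneg_left key hp.le
  rw [mul_sub p (√q / √p), h1] at h2
  nlinarith [sq_sqrt hp.le, sq_sqrt hq.le]

/-- A form of Pinsker's inequality, by way of the Hellinger distance. -/
theorem sq_sum_abs_sub_le_klSum {p q : α → ℝ} (hp : p ∈ stdSimplex ℝ α) (hq : q ∈ stdSimplex ℝ α)
    (h : ∀ a, q a = 0 → p a = 0) : (∑ a, |p a - q a|) ^ 2 ≤ 4 * klSum p q := by
  have h1 : ∑ a, (√(p a) - √(q a)) ^ 2 ≤ klSum p q := by
    refine (Finset.sum_le_sum fun a _ =>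
      sq_sqrt_sub_sqrt_le (hp.1 a) (hq.1 a) (h a)).trans_eq ?_
    rw [Finset.sum_add_distrib, Finset.sum_sub_distrib, hp.2, hq.2, klSum]
    ring
  have h2 : ∑ a, (√(p a) + √(q a)) ^ 2 ≤ 4 := by
    have : ∑ a, (2 * p a + 2 * q a) = 4 := by
      rw [Finset.sum_add_distrib, ← Finset.mul_sum, ← Finset.mul_sum, hp.2, hq.2]; norm_num
    rw [← this]
    refine Finset.sum_le_sum fun a _ => ?_
    nlinarith [sq_sqrt (hp.1 a), sq_sqrt (hq.1 a), sq_nonneg (√(p a) - √(q a))]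
  have h3 : ∀ a, |p a - q a| = |√(p a) - √(q a)| * (√(p a) + √(q a)) := fun a => by
    rw [← abs_of_nonneg (add_nonneg (sqrt_nonneg (p a)) (sqrt_nonneg (q a))), ← abs_mul]
    congr 1
    nlinarith [sq_sqrt (hp.1 a), sq_sqrt (hq.1 a)]
  simp only [h3]
  refine (Finset.sum_mul_sq_le_sq_mul_sq _ _ _).trans ?_
  simp only [sq_abs]
  have h4 : 0 ≤ ∑ a, (√(p a) - √(q a)) ^ 2 := Finset.sum_nonneg fun a _ => sq_nonneg _
  nlinarith

theorem klSum_nonneg {p q : α → ℝ} (hp : p ∈ stdSimplex ℝ α) (hq : q ∈ stdSimplex ℝ α)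
    (h : ∀ a, q a = 0 → p a = 0) : 0 ≤ klSum p q := by
  nlinarith [sq_sum_abs_sub_le_klSum hp hq h, sq_nonneg (∑ a, |p a - q a|)]

theorem entropy_nonneg {p : α → ℝ} (hp : p ∈ stdSimplex ℝ α) : 0 ≤ entropy p :=
  Finset.sum_nonneg fun a _ => negMulLog_nonneg (hp.1 a) <| hp.2 ▸
    Finset.single_le_sum (fun a _ => hp.1 a) (Finset.mem_univ a)

theorem entropy_le_log_card [Nonempty α] {p : α → ℝ} (hp : p ∈ stdSimplex ℝ α) :
    entropy p ≤ log (Fintype.card α) := by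
  have hc : (Fintype.card α : ℝ) ≠ 0 := by simp
  have h := klSum_nonneg (q := fun _ => (Fintype.card α : ℝ)⁻¹) hp
    ⟨fun a => by positivity, by simp⟩ (fun a h => absurd h (inv_ne_zero hc))
  have h2 : klSum p (fun _ => (Fintype.card α : ℝ)⁻¹) =
      ∑ a, (p a * log (Fintype.card α) - negMulLog (p a)) :=
    Finset.sum_congr rfl fun a _ => by rw [log_inv, negMulLog]; ring
  rw [h2, Finset.sum_sub_distrib, ← Finset.sum_mul, hp.2, one_mul] at h
  exact sub_nonneg.1 h

/-- Averaging increases the entropy if two of the averaged vectors are far apart. -/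
theorem add_le_entropy_mixture [DecidableEq β] {p : β → α → ℝ}
    (hp : ∀ b, p b ∈ stdSimplex ℝ α) {i j : β} (hij : i ≠ j) {r : ℝ} (hr : 0 ≤ r)
    (h : r ≤ ∑ a, |p i a - p j a|) :
    (Fintype.card β : ℝ)⁻¹ * ∑ b, entropy (p b) + (Fintype.card β : ℝ)⁻¹ * (r ^ 2 / 8) ≤
      entropy (mixture p) := by
  have : Nonempty β := ⟨i⟩
  rw [entropy_mixture]
  gcongr
  have hav := mixture_mem_stdSimplex hp
  have h0 := fun b a => eq_zero_of_mixture_eq_zero hp (a := a) (b := b)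
  have hi := sq_sum_abs_sub_le_klSum (hp i) hav fun a h => h0 i a h
  have hj := sq_sum_abs_sub_le_klSum (hp j) hav fun a h => h0 j a h
  have hsum : klSum (p i) (mixture p) + klSum (p j) (mixture p) ≤
      ∑ b, klSum (p b) (mixture p) := by
    rw [← Finset.sum_pair hij (f := fun b => klSum (p b) (mixture p))]
    exact Finset.sum_le_sum_of_subset_of_nonneg (Finset.subset_univ _)
      fun b _ _ => klSum_nonneg (hp b) hav fun a h => h0 b a h
  have htri : r ≤ ∑ a, |p i a - mixture p a| + ∑ a, |p j a - mixture p a| := by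
    rw [← Finset.sum_add_distrib]
    refine h.trans (Finset.sum_le_sum fun a _ => ?_)
    rw [abs_sub_comm (p j a)]
    exact abs_sub_le _ _ _
  nlinarith [sq_nonneg (∑ a, |p i a - mixture p a| - ∑ a, |p j a - mixture p a|)]

theorem mul_log_sub_log_le {p q o : ℝ} (hp : 0 ≤ p) (hq : 0 ≤ q) (ho : 0 ≤ o) :
    p * (log (p + q + o) - log p) ≤ q + 2 * √(p * o) := by
  rcases hp.eq_or_lt with rfl | hp
  · simp [hq]
  have h1 : log (p + q + o) ≤ log ((p + q) * ((p + o) / p)) := by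
    refine log_le_log (by positivity) ?_
    rw [mul_div_assoc', le_div_iff₀ hp]
    nlinarith [mul_nonneg hq ho]
  rw [log_mul (by positivity) (by positivity)] at h1
  have h2 : log (p + q) - log p ≤ (p + q) / p - 1 := by
    rw [← log_div (by positivity) hp.ne']
    exact log_le_sub_one_of_pos (by positivity)
  have h3 : log ((p + o) / p) ≤ 2 * √(o / p) := by
    have e1 : (p + o) / p = 1 + o / p := by field_simp
    have hx : 0 ≤ o / p := by positivity
    rw [e1]
    calc log (1 + o / p) ≤ log ((1 + √(o / p)) ^ 2) := by
          refine log_le_log (by positivity) ?_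
          nlinarith [sq_sqrt hx, sqrt_nonneg (o / p)]
      _ = 2 * log (1 + √(o / p)) := by rw [log_pow]; norm_num
      _ ≤ 2 * √(o / p) := by
          have := log_le_sub_one_of_pos (show 0 < 1 + √(o / p) by positivity)
          linarith
  have h4 : p * √(o / p) = √(p * o) := by
    rw [← sqrt_sq hp.le, ← sqrt_mul (sq_nonneg p), sqrt_sq hp.le]
    congr 1
    field_simp
  have h5 : p * ((p + q) / p - 1) = q := by field_simp; ring
  calc p * (log (p + q + o) - log p) ≤ p * (((p + q) / p - 1) + 2 * √(o / p)) := by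
        gcongr; linarith
    _ = q + 2 * √(p * o) := by rw [mul_add, h5, ← h4]; ring

theorem min_sum_le_sum_min {ι : Type*} (s : Finset ι) (f : ι → ℝ) (hf : ∀ b, 0 ≤ f b) {x : ℝ}
    (hx : 0 ≤ x) : min x (∑ b ∈ s, f b) ≤ ∑ b ∈ s, min x (f b) := by
  classical
  induction s using Finset.induction_on with
  | empty => simp [hx]
  | insert b s hb ih =>
    rw [Finset.sum_insert hb, Finset.sum_insert hb]
    have := Finset.sum_nonneg fun b (_ : b ∈ s) => hf b
    have := hf b
    rcases le_total x (f b) with h1 | h1 <;> rcases le_total x (∑ b ∈ s, f b) with h2 | h2 <;>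
      simp only [h1, h2, min_eq_left, min_eq_right] at ih ⊢
    · exact (min_le_left _ _).trans (by linarith)
    · exact (min_le_left _ _).trans
        (le_add_of_nonneg_right (Finset.sum_nonneg fun b _ => le_min hx (hf b)))
    · exact (min_le_left _ _).trans (by linarith)
    · exact (min_le_right _ _).trans (by linarith)

/-- Averaging increases the entropy by `log |β| - O(1)` if the averaged vectors come in pairs
`b, σ b` such that vectors of different pairs are nearly disjointly supported. -/
theorem log_card_le_entropy_mixture [DecidableEq β] [Nonempty β] {p : β → α → ℝ}
    (hp : ∀ b, p b ∈ stdSimplex ℝ α) {σ : β → β} (hσ : ∀ b, σ b ≠ b) {δ : ℝ} (hδ0 : 0 ≤ δ)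
    (h : ∀ b j, j ≠ b → j ≠ σ b → ∑ a, min (p b a) (p j a) ≤ δ) :
    (Fintype.card β : ℝ)⁻¹ * ∑ b, entropy (p b) +
      (log (Fintype.card β) - 1 - 2 * √((Fintype.card β : ℝ) ^ 2 * δ)) ≤
      entropy (mixture p) := by
  set M : ℝ := (Fintype.card β : ℝ) with hM
  have hM0 : 0 < M := by rw [hM]; positivity
  suffices hb : ∀ b, log M - 1 - 2 * √(M ^ 2 * δ) ≤ klSum (p b) (mixture p) by
    rw [entropy_mixture]
    gcongr
    rw [inv_mul_eq_div, le_div_iff₀ hM0, mul_comm, hM, ← nsmul_eq_mul]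
    exact Finset.card_nsmul_le_sum _ _ _ fun b _ => hb b
  intro b
  let s : Finset β := Finset.univ.filter fun j => j ≠ b ∧ j ≠ σ b
  let o : α → ℝ := fun a => ∑ j ∈ s, p j a
  have ho : ∀ a, 0 ≤ o a := fun a => Finset.sum_nonneg fun j _ => (hp j).1 a
  have hsum : ∀ a, ∑ j, p j a = p b a + p (σ b) a + o a := fun a => by
    rw [← Finset.sum_filter_add_sum_filter_not Finset.univ (fun j => j ≠ b ∧ j ≠ σ b), add_comm]
    congr 1
    rw [← Finset.sum_pair (hσ b).symm (f := fun j => p j a)]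
    refine Finset.sum_congr ?_ fun _ _ => rfl
    ext j
    simp only [Finset.mem_filter, Finset.mem_univ, true_and, Finset.mem_insert,
      Finset.mem_singleton]
    tauto
  have hs : (s.card : ℝ) ≤ M := by
    rw [hM]; exact_mod_cast Finset.card_le_univ s
  have hδ : ∀ j ∈ s, ∑ a, min (p b a) (p j a) ≤ δ := fun j hj =>
    h b j (Finset.mem_filter.1 hj).2.1 (Finset.mem_filter.1 hj).2.2
  have hmin : ∑ a, min (p b a) (o a) ≤ s.card * δ := by
    calc ∑ a, min (p b a) (o a) ≤ ∑ a, ∑ j ∈ s, min (p b a) (p j a) :=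
          Finset.sum_le_sum fun a _ =>
            min_sum_le_sum_min s _ (fun j => (hp j).1 a) ((hp b).1 a)
      _ = ∑ j ∈ s, ∑ a, min (p b a) (p j a) := Finset.sum_comm
      _ ≤ s.card * δ := by
          rw [← nsmul_eq_mul]; exact Finset.sum_le_card_nsmul _ _ _ hδ
  have hmin' : ∑ a, min (p b a) (o a) ≤ M * δ := hmin.trans (by gcongr)
  have hmax : ∑ a, max (p b a) (o a) ≤ M := by
    calc ∑ a, max (p b a) (o a) ≤ ∑ a, ∑ j, p j a := by
          refine Finset.sum_le_sum fun a _ => ?_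
          rw [hsum]
          have h1 := (hp b).1 a
          have h2 := (hp (σ b)).1 a
          exact max_le (by linarith [ho a]) (by linarith [ho a])
      _ = M := by
          rw [Finset.sum_comm, Finset.sum_congr rfl fun j _ => (hp j).2]
          simp [hM]
  have hsqrt : ∑ a, √(p b a * o a) ≤ √(M ^ 2 * δ) := by
    have hm0 : ∀ a, 0 ≤ min (p b a) (o a) := fun a => le_min ((hp b).1 a) (ho a)
    have hm1 : ∀ a, 0 ≤ max (p b a) (o a) := fun a => le_max_of_le_right (ho a)
    calc ∑ a, √(p b a * o a) = ∑ a, √(min (p b a) (o a)) * √(max (p b a) (o a)) :=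
          Finset.sum_congr rfl fun a _ => by rw [← sqrt_mul (hm0 a), min_mul_max]
      _ ≤ √(∑ a, min (p b a) (o a)) * √(∑ a, max (p b a) (o a)) :=
          sum_sqrt_mul_sqrt_le _ hm0 hm1
      _ ≤ √(M * δ) * √M := by gcongr
      _ = √(M ^ 2 * δ) := by
          rw [← sqrt_mul' _ hM0.le]; congr 1; ring
  have hkl : klSum (p b) (mixture p) =
      log M - ∑ a, p b a * (log (p b a + p (σ b) a + o a) - log (p b a)) := by
    rw [eq_sub_iff_add_eq, klSum, ← Finset.sum_add_distrib]
    calc _ = ∑ a, p b a * log M := by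
          refine Finset.sum_congr rfl fun a _ => ?_
          by_cases h0 : p b a = 0
          · simp [h0]
          have hav : mixture p a = M⁻¹ * (p b a + p (σ b) a + o a) := by rw [mixture, hsum]
          have hpos : 0 < p b a + p (σ b) a + o a := by
            have := ((hp b).1 a).lt_of_ne (Ne.symm h0)
            linarith [(hp (σ b)).1 a, ho a]
          rw [hav, log_mul (by positivity) hpos.ne', log_inv]
          ring
      _ = log M := by rw [← Finset.sum_mul, (hp b).2, one_mul]
  have hle : ∑ a, p b a * (log (p b a + p (σ b) a + o a) - log (p b a)) ≤
      1 + 2 * ∑ a, √(p b a * o a) := by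
    rw [← (hp (σ b)).2, Finset.mul_sum, ← Finset.sum_add_distrib]
    exact Finset.sum_le_sum fun a _ =>
      mul_log_sub_log_le ((hp b).1 a) ((hp (σ b)).1 a) (ho a)
  rw [hkl]
  linarith

end Entropy

/-! ### Nearly isometric cycles in `ℓ₁` -/

section Cycle

variable {ι : Type*} [Fintype ι] {k : ℕ} {D : ℝ}

/-- The antipodal edge on a cycle of length `2k`. -/
def antipode (b : Fin (2 * k)) : Fin (2 * k) :=
  ⟨if (b : ℕ) < k then b + k else b - k, by have := b.isLt; split_ifs <;> omega⟩

theorem antipode_val (b : Fin (2 * k)) :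
    (antipode b : ℕ) = if (b : ℕ) < k then (b : ℕ) + k else b - k := rfl

theorem antipode_antipode (b : Fin (2 * k)) : antipode (antipode b) = b := by
  have := b.isLt
  ext
  rw [antipode_val, antipode_val]
  split_ifs <;> omega

theorem antipode_ne (b : Fin (2 * k)) : antipode b ≠ b := by
  have := b.isLt
  intro h
  have h := congrArg Fin.val h
  rw [antipode_val] at h
  split_ifs at h <;> omega

/-- The steps `x b` of a closed walk of length `2k` in `ℓ₁^ι` that is the image of a `2k`-cycle
under a map with distortion `D`, scaled so that their norms are at most `1`. -/
structure IsNearlyIsometricCycle (k : ℕ) (D : ℝ) (x : Fin (2 * k) → ι → ℝ) : Prop where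
  sum_eq_zero : ∀ c, ∑ b, x b c = 0
  le_norm : ∀ b, 1 / D ≤ ∑ c, |x b c|
  le_norm_add : ∀ i j, i ≠ j → j ≠ antipode i → k / D - (k - 2) ≤ ∑ c, |x i c + x j c|

/-- Two steps out of a set of `k` steps cannot nearly cancel if all of them together do not. -/
theorem le_sum_abs_add {β : Type*} [DecidableEq β] {x : β → ι → ℝ} {W : Finset β} {r : ℝ}
    (hx : ∀ b, ∑ c, |x b c| ≤ 1) (hW : r ≤ ∑ c, |∑ b ∈ W, x b c|)
    {i j : β} (hi : i ∈ W) (hj : j ∈ W) (hij : i ≠ j) :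
    r - (W.card - 2) ≤ ∑ c, |x i c + x j c| := by
  have hsub : ({i, j} : Finset β) ⊆ W := by
    simp [Finset.insert_subset_iff, hi, hj]
  have hcard : ((W \ {i, j}).card : ℝ) = W.card - 2 := by
    rw [Finset.card_sdiff_of_subset hsub, Nat.cast_sub (Finset.card_le_card hsub),
      Finset.card_pair hij]
    norm_num
  have h1 : ∑ c, |∑ b ∈ W, x b c| ≤
      ∑ c, (|x i c + x j c| + ∑ b ∈ W \ {i, j}, |x b c|) := by
    refine Finset.sum_le_sum fun c _ => ?_
    rw [← Finset.sum_sdiff hsub, Finset.sum_pair hij, add_comm]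
    exact (abs_add_le _ _).trans (add_le_add_right (Finset.abs_sum_le_sum_abs _ _) _)
  rw [Finset.sum_add_distrib, Finset.sum_comm] at h1
  have h2 : ∑ b ∈ W \ {i, j}, ∑ c, |x b c| ≤ W.card - 2 := by
    rw [← hcard]
    simpa using Finset.sum_le_card_nsmul (W \ {i, j}) _ 1 fun b _ => hx b
  linarith

theorem sum_filter_window (f : ℕ → ℝ) {t : ℕ} (ht : t ≤ k) :
    ∑ b ∈ Finset.univ.filter (fun b : Fin (2 * k) => t ≤ (b : ℕ) ∧ (b : ℕ) < t + k),
      (f (b + 1) - f b) = f (t + k) - f t := by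
  rw [Finset.sum_filter,
    Fin.sum_univ_eq_sum_range (fun b => if t ≤ b ∧ b < t + k then f (b + 1) - f b else 0),
    ← Finset.sum_filter]
  have : Finset.filter (fun b => t ≤ b ∧ b < t + k) (Finset.range (2 * k)) =
      Finset.Ico t (t + k) := by
    ext b
    simp only [Finset.mem_filter, Finset.mem_range, Finset.mem_Ico]
    omega
  rw [this, Finset.sum_Ico_eq_sub _ (by omega), Finset.sum_range_sub, Finset.sum_range_sub]
  ring

theorem card_filter_window {t : ℕ} (ht : t ≤ k) :
    (Finset.univ.filter (fun b : Fin (2 * k) => t ≤ (b : ℕ) ∧ (b : ℕ) < t + k)).card = k := by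
  have h := sum_filter_window (k := k) (fun m => (m : ℝ)) ht
  have : ∀ b : Fin (2 * k), (((b : ℕ) + 1 : ℕ) : ℝ) - ((b : ℕ) : ℝ) = 1 := fun b => by
    push_cast; ring
  simp only [this, Finset.sum_const, nsmul_eq_mul, mul_one] at h
  push_cast at h
  have h' : ((Finset.univ.filter
    (fun b : Fin (2 * k) => t ≤ (b : ℕ) ∧ (b : ℕ) < t + k)).card : ℝ) = (k : ℝ) := by linarith
  exact_mod_cast h'

/-- The steps of a closed walk whose antipodal points are far apart satisfy
`IsNearlyIsometricCycle`: two steps that are not antipodal lie on a common arc of length `k`. -/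
theorem isNearlyIsometricCycle_of_walk {f : ℕ → ι → ℝ} {s : ℝ} (hD : 0 < D) (hs : 0 < s)
    (hclosed : f (2 * k) = f 0)
    (hlow : ∀ t < 2 * k, s ≤ ∑ c, |f (t + 1) c - f t c|)
    (hupp : ∀ t < 2 * k, ∑ c, |f (t + 1) c - f t c| ≤ D * s)
    (hanti : ∀ t ≤ k, k * s ≤ ∑ c, |f (t + k) c - f t c|) :
    IsNearlyIsometricCycle k D
      fun (b : Fin (2 * k)) c => (D * s)⁻¹ * (f (b + 1) c - f b c) := by
  have hDs : 0 < D * s := mul_pos hD hs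
  have habs : ∀ g : ι → ℝ, ∑ c, |(D * s)⁻¹ * g c| = (D * s)⁻¹ * ∑ c, |g c| := fun g => by
    simp only [abs_mul, abs_of_pos (inv_pos.2 hDs), Finset.mul_sum]
  have hsum : ∀ c, ∑ b : Fin (2 * k), (D * s)⁻¹ * (f (b + 1) c - f b c) = 0 := fun c => by
    rw [← Finset.mul_sum, Fin.sum_univ_eq_sum_range (fun b => f (b + 1) c - f b c),
      Finset.sum_range_sub (fun b => f b c), hclosed, sub_self, mul_zero]
  have hnorm : ∀ b : Fin (2 * k), ∑ c, |(D * s)⁻¹ * (f (b + 1) c - f b c)| ≤ 1 := fun b => by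
    rw [habs, inv_mul_le_iff₀ hDs, mul_one]
    exact hupp b b.isLt
  -- The steps along an arc of length `k`, in or outside of `[t, t + k)`, do not nearly cancel.
  have hwin : ∀ t ≤ k, (k : ℝ) / D ≤ ∑ c, |∑ b ∈ Finset.univ.filter
      (fun b : Fin (2 * k) => t ≤ (b : ℕ) ∧ (b : ℕ) < t + k),
        (D * s)⁻¹ * (f (b + 1) c - f b c)| := fun t ht => by
    have h : ∀ c, ∑ b ∈ Finset.univ.filter
        (fun b : Fin (2 * k) => t ≤ (b : ℕ) ∧ (b : ℕ) < t + k),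
          (D * s)⁻¹ * (f (b + 1) c - f b c) = (D * s)⁻¹ * (f (t + k) c - f t c) := fun c => by
      rw [← Finset.mul_sum, sum_filter_window (fun b => f b c) ht]
    simp only [h]
    rw [habs, div_le_iff₀ hD, ← div_eq_inv_mul, div_mul_eq_mul_div, le_div_iff₀ hDs]
    nlinarith [hanti t ht]
  have hpair : ∀ i j : Fin (2 * k), i < j → j ≠ antipode i → (k : ℝ) / D - (k - 2) ≤
      ∑ c, |(D * s)⁻¹ * (f (i + 1) c - f i c) + (D * s)⁻¹ * (f (j + 1) c - f j c)| := by
    intro i j hij hne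
    have hij' : (i : ℕ) < j := hij
    have hj := j.isLt
    rcases lt_or_ge (j : ℕ) (i + k) with h | h
    · have ht : min (i : ℕ) k ≤ k := min_le_right _ _
      have := le_sum_abs_add hnorm (hwin _ ht) (i := i) (j := j)
        (by simp only [Finset.mem_filter, Finset.mem_univ, true_and]; omega)
        (by simp only [Finset.mem_filter, Finset.mem_univ, true_and]; omega) hij.ne
      rwa [card_filter_window ht] at this
    · have h' : (j : ℕ) ≠ i + k := fun h' => hne <| Fin.ext <| by
        rw [antipode_val, if_pos (by omega), h']
      have ht : (i : ℕ) + 1 ≤ k := by omega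
      have hc := hwin _ ht
      have hcompl : ∀ c, |∑ b ∈ Finset.univ.filter
          (fun b : Fin (2 * k) => (i : ℕ) + 1 ≤ (b : ℕ) ∧ (b : ℕ) < i + 1 + k),
            (D * s)⁻¹ * (f (b + 1) c - f b c)| = |∑ b ∈ (Finset.univ.filter
          (fun b : Fin (2 * k) => (i : ℕ) + 1 ≤ (b : ℕ) ∧ (b : ℕ) < i + 1 + k))ᶜ,
            (D * s)⁻¹ * (f (b + 1) c - f b c)| := fun c => by
        rw [← abs_neg]
        congr 1
        rw [neg_eq_iff_add_eq_zero, Finset.sum_add_sum_compl, hsum]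
      simp only [hcompl] at hc
      have := le_sum_abs_add hnorm hc (i := i) (j := j)
        (by simp) (by simp; omega) hij.ne
      rw [Finset.card_compl, card_filter_window ht, Fintype.card_fin] at this
      rwa [show 2 * k - k = k by omega] at this
  refine ⟨hsum, fun b => ?_, fun i j hij hne => ?_⟩
  · rw [habs, div_le_iff₀ hD, ← div_eq_inv_mul, div_mul_eq_mul_div, le_div_iff₀ hDs]
    nlinarith [hlow b b.isLt]
  · rcases lt_or_gt_of_ne hij with h | h
    · exact hpair i j h hne
    · simp only [add_comm ((D * s)⁻¹ * (f (i + 1) _ - f i _))]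
      exact hpair j i h fun h' => hne (by rw [h', antipode_antipode])

/-- The probability vectors `p b` on the alphabet of signed coordinates, with an additional symbol
`none`, represent the steps `x b` of a `2k`-cycle. The edges of the cycle are oriented from left to
right, so that the steps `b ≥ k` run against their edges. -/
structure Represents (p : Fin (2 * k) → Option (ι × Bool) → ℝ) (x : Fin (2 * k) → ι → ℝ) :
    Prop where
  mem_stdSimplex : ∀ b, p b ∈ stdSimplex ℝ (Option (ι × Bool))
  sub_eq : ∀ b c, p b (some (c, true)) - p b (some (c, false)) =
    if (b : ℕ) < k then x b c else -x b c

theorem sum_option_prod_bool (g : Option (ι × Bool) → ℝ) :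
    ∑ a, g a = g none + ∑ c, (g (some (c, true)) + g (some (c, false))) := by
  rw [Fintype.sum_option, Fintype.sum_prod_type]
  simp

variable {p : Fin (2 * k) → Option (ι × Bool) → ℝ} {x : Fin (2 * k) → ι → ℝ}

theorem sum_abs_add_le_sum_abs_sub (hp : Represents p x) {i j : Fin (2 * k)} (hi : (i : ℕ) < k)
    (hj : k ≤ (j : ℕ)) : ∑ c, |x i c + x j c| ≤ ∑ a, |p i a - p j a| := by
  rw [sum_option_prod_bool]
  refine le_add_of_nonneg_of_le (abs_nonneg _) (Finset.sum_le_sum fun c _ => ?_)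
  have h1 := hp.sub_eq i c
  have h2 := hp.sub_eq j c
  rw [if_pos hi] at h1
  rw [if_neg (by omega)] at h2
  have : x i c + x j c = (p i (some (c, true)) - p j (some (c, true))) -
      (p i (some (c, false)) - p j (some (c, false))) := by linarith
  rw [this]
  exact abs_sub _ _

/-- The entropy gained on a `4`-cycle: the two edges at the left endpoint of the cycle are
represented by vectors at distance at least `2 / D`. -/
theorem entropy_gain_four_cycle (hD : 0 < D) {p : Fin (2 * 2) → Option (ι × Bool) → ℝ}
    {x : Fin (2 * 2) → ι → ℝ} (hx : IsNearlyIsometricCycle 2 D x) (hp : Represents p x) :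
    (Fintype.card (Fin (2 * 2)) : ℝ)⁻¹ * ∑ b, entropy (p b) + 1 / (8 * D ^ 2) ≤
      entropy (mixture p) := by
  have h1 := hx.le_norm_add 0 3 (by decide) (by decide)
  have h2 := sum_abs_add_le_sum_abs_sub hp (i := 0) (j := 3) (by decide) (by decide)
  have h3 := add_le_entropy_mixture hp.mem_stdSimplex (i := 0) (j := 3) (by decide)
    (show 0 ≤ 2 / D by positivity) (le_trans (by simpa using h1) h2)
  convert h3 using 2
  rw [Fintype.card_fin]
  field_simp
  norm_num

/-- The weight of the coordinate `c` with sign `τ` in the step `b`; steps against the orientation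
of their edges have the signs exchanged. -/
def weight (p : Fin (2 * k) → Option (ι × Bool) → ℝ) (b : Fin (2 * k)) (c : ι) (τ : Bool) : ℝ :=
  p b (some (c, if (b : ℕ) < k then τ else !τ))

theorem weight_nonneg (hp : Represents p x) (b : Fin (2 * k)) (c : ι) (τ : Bool) :
    0 ≤ weight p b c τ := (hp.mem_stdSimplex b).1 _

theorem weight_sub_weight (hp : Represents p x) (b : Fin (2 * k)) (c : ι) :
    weight p b c true - weight p b c false = x b c := by
  have h := hp.sub_eq b c
  unfold weight
  split_ifs with hb
  · simpa [hb] using h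
  · rw [if_neg hb] at h
    simp only [Bool.not_true, Bool.not_false]
    linarith

theorem none_add_sum_weight (hp : Represents p x) (b : Fin (2 * k)) :
    p b none + ∑ c, (weight p b c true + weight p b c false) = 1 := by
  rw [← (hp.mem_stdSimplex b).2, sum_option_prod_bool]
  congr 1
  refine Finset.sum_congr rfl fun c _ => ?_
  unfold weight
  split_ifs <;> simp [add_comm]

theorem sum_weight (hx : IsNearlyIsometricCycle k D x) (hp : Represents p x) (c : ι) (τ : Bool) :
    ∑ b, weight p b c τ = ∑ b, weight p b c (!τ) := by
  have h := hx.sum_eq_zero c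
  simp only [← weight_sub_weight hp, Finset.sum_sub_distrib] at h
  cases τ
  · simpa using (sub_eq_zero.1 h).symm
  · simpa using sub_eq_zero.1 h

theorem none_le {ε : ℝ} (hε : 0 < ε) (hx : IsNearlyIsometricCycle k (1 + ε) x)
    (hp : Represents p x) (b : Fin (2 * k)) : p b none ≤ ε := by
  have h1 := none_add_sum_weight hp b
  have h2 : ∑ c, |x b c| ≤ ∑ c, (weight p b c true + weight p b c false) := by
    refine Finset.sum_le_sum fun c _ => ?_
    rw [← weight_sub_weight hp]
    have h1 := weight_nonneg hp b c true
    have h2 := weight_nonneg hp b c false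
    exact abs_sub_le_iff.2 ⟨by linarith, by linarith⟩
  have h3 : 1 - ε ≤ 1 / (1 + ε) := by
    rw [le_div_iff₀ (by positivity)]; nlinarith
  linarith [hx.le_norm b]

/-- Steps that are not antipodal hardly cancel. -/
theorem sum_min_weight_not_le {ε : ℝ} (hε : 0 < ε) (hk : 2 ≤ k)
    (hx : IsNearlyIsometricCycle k (1 + ε) x) (hp : Represents p x)
    {i j : Fin (2 * k)} (hij : j ≠ antipode i) (τ : Bool) :
    ∑ c, min (weight p i c τ) (weight p j c (!τ)) ≤ k * ε / 2 := by
  have h3 : 1 - ε ≤ 1 / (1 + ε) := by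
    rw [le_div_iff₀ (by positivity)]; nlinarith
  have hk' : (2 : ℝ) ≤ k := by exact_mod_cast hk
  have h : 2 - k * ε ≤ ∑ c, |x i c + x j c| := by
    by_cases h : i = j
    · subst h
      have h1 := hx.le_norm i
      have h2 : ∑ c, |x i c + x i c| = 2 * ∑ c, |x i c| := by
        rw [Finset.mul_sum]
        exact Finset.sum_congr rfl fun c _ => by rw [← two_mul, abs_mul, abs_two]
      rw [h2]
      nlinarith
    · have h1 := hx.le_norm_add i j h hij
      have h2 : (k : ℝ) / (1 + ε) = k * (1 / (1 + ε)) := by ring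
      nlinarith
  have h1 := none_add_sum_weight hp i
  have h2 := none_add_sum_weight hp j
  have h4 := (hp.mem_stdSimplex i).1 none
  have h5 := (hp.mem_stdSimplex j).1 none
  have h6 : ∑ c, |x i c + x j c| + 2 * ∑ c, min (weight p i c τ) (weight p j c (!τ)) ≤
      ∑ c, (weight p i c true + weight p i c false) +
      ∑ c, (weight p j c true + weight p j c false) := by
    rw [Finset.mul_sum, ← Finset.sum_add_distrib, ← Finset.sum_add_distrib]
    refine Finset.sum_le_sum fun c _ => ?_
    rw [← weight_sub_weight hp, ← weight_sub_weight hp]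
    have g1 := weight_nonneg hp i c true
    have g2 := weight_nonneg hp i c false
    have g3 := weight_nonneg hp j c true
    have g4 := weight_nonneg hp j c false
    cases τ <;> simp only [Bool.not_true, Bool.not_false]
    · have m1 := min_le_left (weight p i c false) (weight p j c true)
      have m2 := min_le_right (weight p i c false) (weight p j c true)
      rw [← le_sub_iff_add_le, abs_le]
      constructor <;> linarith
    · have m1 := min_le_left (weight p i c true) (weight p j c false)
      have m2 := min_le_right (weight p i c true) (weight p j c false)
      rw [← le_sub_iff_add_le, abs_le]
      constructor <;> linarith
  linarith

/-- Different steps have nearly disjoint weights of the same sign. As the steps sum to zero, a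
common weight of `i` and `j` would have to be cancelled by steps `l`, and no `l` is antipodal to
both `i` and `j`. -/
theorem sum_min_weight_le {ε : ℝ} (hε : 0 < ε) (hk : 2 ≤ k)
    (hx : IsNearlyIsometricCycle k (1 + ε) x) (hp : Represents p x)
    {i j : Fin (2 * k)} (hij : i ≠ j) (τ : Bool) :
    ∑ c, min (weight p i c τ) (weight p j c τ) ≤ k ^ 2 * ε := by
  calc ∑ c, min (weight p i c τ) (weight p j c τ)
      ≤ ∑ c, ∑ l, min (min (weight p i c τ) (weight p j c τ)) (weight p l c (!τ)) := by
        refine Finset.sum_le_sum fun c _ => ?_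
        refine le_trans (le_min le_rfl ?_) (min_sum_le_sum_min Finset.univ _
          (fun l => weight_nonneg hp l c _)
          (le_min (weight_nonneg hp i c τ) (weight_nonneg hp j c τ)))
        rw [← sum_weight hx hp]
        exact (min_le_left _ _).trans
          (Finset.single_le_sum (fun l _ => weight_nonneg hp l c τ) (Finset.mem_univ i))
    _ = ∑ l, ∑ c, min (min (weight p i c τ) (weight p j c τ)) (weight p l c (!τ)) :=
        Finset.sum_comm
    _ ≤ ∑ l : Fin (2 * k), k * ε / 2 := by
        refine Finset.sum_le_sum fun l _ => ?_
        by_cases hl : l = antipode i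
        · have hl' : l ≠ antipode j := fun h => hij <| by
            rw [← antipode_antipode i, ← hl, h, antipode_antipode]
          refine le_trans (Finset.sum_le_sum fun c _ => ?_)
            (sum_min_weight_not_le hε hk hx hp hl' τ)
          exact min_le_min_right _ (min_le_right _ _)
        · refine le_trans (Finset.sum_le_sum fun c _ => ?_)
            (sum_min_weight_not_le hε hk hx hp hl τ)
          exact min_le_min_right _ (min_le_left _ _)
    _ = k ^ 2 * ε := by
        rw [Finset.sum_const, Finset.card_univ, Fintype.card_fin, nsmul_eq_mul]
        push_cast
        ring

theorem sum_min_le {ε : ℝ} (hε : 0 < ε) (hk : 2 ≤ k)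
    (hx : IsNearlyIsometricCycle k (1 + ε) x) (hp : Represents p x)
    {i j : Fin (2 * k)} (hij : j ≠ i) (hij' : j ≠ antipode i) :
    ∑ a, min (p i a) (p j a) ≤ 3 * k ^ 2 * ε := by
  have hk' : (2 : ℝ) ≤ k := by exact_mod_cast hk
  have h0 : min (p i none) (p j none) ≤ ε := (min_le_left _ _).trans (none_le hε hx hp i)
  have s1 := sum_min_weight_le hε hk hx hp hij.symm true
  have s2 := sum_min_weight_le hε hk hx hp hij.symm false
  have d1 := sum_min_weight_not_le hε hk hx hp hij' true
  have d2 := sum_min_weight_not_le hε hk hx hp hij' false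
  have e1 : ε ≤ k ^ 2 * ε :=
    le_mul_of_one_le_left hε.le (one_le_pow₀ (by linarith))
  have e2 : k * ε / 2 ≤ k ^ 2 * ε := by nlinarith [mul_pos (show (0 : ℝ) < k by linarith) hε]
  rw [sum_option_prod_bool, Finset.sum_add_distrib]
  unfold weight at s1 s2 d1 d2
  by_cases hi : (i : ℕ) < k <;> by_cases hj : (j : ℕ) < k <;>
    simp only [hi, hj, if_true, if_false, Bool.not_true, Bool.not_false] at s1 s2 d1 d2 <;>
    linarith

/-- The entropy gained on a `2k`-cycle that is embedded almost isometrically: knowing a signed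
coordinate essentially determines the edge up to antipodes. -/
theorem entropy_gain_two_mul_cycle {ε : ℝ} (hε : 0 < ε) (hk : 2 ≤ k) (hkε : k ^ 4 * ε ≤ 1)
    (hx : IsNearlyIsometricCycle k (1 + ε) x) (hp : Represents p x) :
    (Fintype.card (Fin (2 * k)) : ℝ)⁻¹ * ∑ b, entropy (p b) + (Real.log (2 * k) - 9) ≤
      entropy (mixture p) := by
  have : Nonempty (Fin (2 * k)) := ⟨⟨0, by omega⟩⟩
  have h := log_card_le_entropy_mixture hp.mem_stdSimplex antipode_ne
    (show 0 ≤ 3 * (k : ℝ) ^ 2 * ε by positivity)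
    fun i j hij hij' => sum_min_le hε hk hx hp hij hij'
  refine le_trans ?_ h
  have hsqrt : √((Fintype.card (Fin (2 * k)) : ℝ) ^ 2 * (3 * k ^ 2 * ε)) ≤ 4 := by
    rw [Real.sqrt_le_left (by norm_num), Fintype.card_fin]
    push_cast
    nlinarith
  have hcard : (Fintype.card (Fin (2 * k)) : ℝ) = 2 * k := by simp
  rw [hcard] at hsqrt ⊢
  linarith

end Cycle

/-! ### Entropy along the recursion -/

namespace RecursiveCycle

variable {k d : ℕ} {D κ : ℝ}

/-- Going around the cycle that replaces `e` along the edges, one crosses it twice. -/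
theorem sum_sub_endpoints_snoc {n : ℕ} (hk : 0 < k) (g : Vertex k (n + 1) → ℝ) (e : Edge k n) :
    ∑ b : Fin (2 * k), (g (endpoints (Fin.snoc e b : Edge k (n + 1))).2 -
        g (endpoints (Fin.snoc e b : Edge k (n + 1))).1) =
      2 * (g (.old (endpoints e).2) - g (.old (endpoints e).1)) := by
  have h : ∀ b : Fin (2 * k), g (endpoints (Fin.snoc e b : Edge k (n + 1))).2 -
      g (endpoints (Fin.snoc e b : Edge k (n + 1))).1 =
      if (b : ℕ) < k then g (cycleVertex e (b + 1)) - g (cycleVertex e b)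
      else -(g (cycleVertex e (b + 1)) - g (cycleVertex e b)) := fun b => by
    rw [endpoints_snoc hk]
    split_ifs <;> simp
  have h1 := sum_filter_window (fun t => g (cycleVertex e t)) (Nat.zero_le k)
  have h2 := sum_filter_window (fun t => g (cycleVertex e t)) (le_refl k)
  simp only [zero_le, true_and, zero_add] at h1
  have h3 : Finset.univ.filter (fun b : Fin (2 * k) => ¬ (b : ℕ) < k) =
      Finset.univ.filter (fun b : Fin (2 * k) => k ≤ (b : ℕ) ∧ (b : ℕ) < k + k) :=
    Finset.filter_congr fun b _ => by have := b.isLt; omega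
  simp only [h]
  rw [Finset.sum_ite, Finset.sum_neg_distrib, h1, h3, h2, ← two_mul, cycleVertex_two_mul hk,
    cycleVertex_self hk, cycleVertex_zero]
  ring

theorem mixture_snoc {α : Type*} {n : ℕ} (p : Edge k (n + 1) → α → ℝ) :
    mixture p = mixture fun e : Edge k n => mixture fun b => p (Fin.snoc e b) := by
  ext a
  simp only [mixture, sum_snoc, ← Finset.mul_sum, Fintype.card_fun, Fintype.card_fin, pow_succ,
    Nat.cast_mul, mul_inv]
  ring

/-- If averaging over a single nearly isometric cycle increases the entropy by `κ`, then averaging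
over all edges of `G_{k,n}` increases it by `n κ`. -/
theorem entropy_mixture_edges (hk : 0 < k) (hD : 0 < D)
    (gain : ∀ (x : Fin (2 * k) → Fin d → ℝ) (p : Fin (2 * k) → Option (Fin d × Bool) → ℝ),
      IsNearlyIsometricCycle k D x → Represents p x →
      (Fintype.card (Fin (2 * k)) : ℝ)⁻¹ * ∑ b, entropy (p b) + κ ≤ entropy (mixture p)) :
    ∀ (n : ℕ) (f : Vertex k n → Fin d → ℝ) (s : ℝ), 0 < s →
      (∀ u v, s * labelDist u v ≤ ∑ c, |f u c - f v c| ∧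
        ∑ c, |f u c - f v c| ≤ D * (s * labelDist u v)) →
      ∀ p : Edge k n → Option (Fin d × Bool) → ℝ,
      (∀ e, p e ∈ stdSimplex ℝ (Option (Fin d × Bool))) →
      (∀ e c, p e (some (c, true)) - p e (some (c, false)) =
        (D * s)⁻¹ * (f (endpoints e).2 c - f (endpoints e).1 c)) →
      (Fintype.card (Edge k n) : ℝ)⁻¹ * ∑ e, entropy (p e) + n * κ ≤ entropy (mixture p)
  | 0, f, s, hs, hf, p, hp, hpf => by
    rw [entropy_mixture]
    have h : mixture p = p default := by
      ext a; simp [mixture]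
    simp [h, klSum]
  | n + 1, f, s, hs, hf, p, hp, hpf => by
    have hk' : (0 : ℝ) < k := by exact_mod_cast hk
    have hne : Nonempty (Fin (2 * k)) := ⟨⟨0, by omega⟩⟩
    let q : Edge k n → Option (Fin d × Bool) → ℝ := fun e => mixture fun b => p (Fin.snoc e b)
    have ih := entropy_mixture_edges hk hD gain n (fun v => f (.old v)) (s * k) (by positivity)
      (fun u v => by
        have := hf (.old u) (.old v)
        rw [labelDist_old] at this
        rwa [mul_assoc])
      q (fun e => mixture_mem_stdSimplex fun b => hp _)
      (fun e c => by
        have h := sum_sub_endpoints_snoc hk (fun v => f v c) e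
        simp only [q, mixture]
        rw [← mul_sub, ← Finset.sum_sub_distrib]
        simp only [hpf]
        rw [← Finset.mul_sum, h, Fintype.card_fin]
        push_cast
        field_simp)
    have hq : ∀ e, (2 * k : ℝ)⁻¹ * ∑ b, entropy (p (Fin.snoc e b)) + κ ≤ entropy (q e) := by
      intro e
      have hdist : ∀ t < 2 * k, labelDist (cycleVertex e (t + 1)) (cycleVertex e t) = 1 :=
        fun t ht => by rw [labelDist_comm, labelDist_cycleVertex_succ hk e ht]
      have hcyc := isNearlyIsometricCycle_of_walk (k := k) (f := fun t => f (cycleVertex e t)) hD hs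
        (by rw [cycleVertex_two_mul hk, cycleVertex_zero])
        (fun t ht => by
          simpa [hdist t ht] using (hf (cycleVertex e (t + 1)) (cycleVertex e t)).1)
        (fun t ht => by
          simpa [hdist t ht] using (hf (cycleVertex e (t + 1)) (cycleVertex e t)).2)
        (fun t ht => by
          have := (hf (cycleVertex e (t + k)) (cycleVertex e t)).1
          rwa [labelDist_comm, labelDist_cycleVertex_add hk e ht, mul_comm] at this)
      have hrep : Represents (fun b => p (Fin.snoc e b)) (fun (b : Fin (2 * k)) c =>
          (D * s)⁻¹ * (f (cycleVertex e (b + 1)) c - f (cycleVertex e b) c)) :=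
        ⟨fun b => hp _, fun b c => by
          rw [hpf, endpoints_snoc hk]
          split_ifs
          · rfl
          · rw [← mul_neg, neg_sub]⟩
      simpa using gain _ _ hcyc hrep
    rw [mixture_snoc]
    refine le_trans (le_of_eq_of_le ?_ (add_le_add_left (mul_le_mul_of_nonneg_left
      (Finset.sum_le_sum fun e (_ : e ∈ Finset.univ) => hq e)
      (inv_nonneg.2 (Nat.cast_nonneg (Fintype.card (Edge k n))))) _)) ih
    rw [Finset.sum_add_distrib, ← Finset.mul_sum, sum_snoc, Finset.sum_const, Finset.card_univ,
      nsmul_eq_mul]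
    have hc : (Fintype.card (Edge k n) : ℝ) ≠ 0 := by simp; intro h; omega
    have hc' : (Fintype.card (Edge k (n + 1)) : ℝ) = Fintype.card (Edge k n) * (2 * k) := by
      simp [pow_succ]
    rw [hc', mul_add, inv_mul_cancel_left₀ hc, mul_inv]
    push_cast
    ring

theorem dist_label {n : ℕ} (u v : Vertex k n) :
    dist (WithLp.toLp 1 (label u) : Ell1 (Fin n → Fin k)) (WithLp.toLp 1 (label v)) =
      labelDist u v := by
  simp [PiLp.dist_eq_of_L1, labelDist, Real.dist_eq]

/-- The signed coordinates of `F(v) - F(u)` for a random edge `(u, v)` of `G_{k,n}` carry at least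
`n κ` nats of information about the edge, so `n κ` is at most the logarithm of the size of the
alphabet. -/
theorem mul_le_log_of_embedsWithDistortion (hk : 0 < k) (hD : 0 < D)
    (gain : ∀ (x : Fin (2 * k) → Fin d → ℝ) (p : Fin (2 * k) → Option (Fin d × Bool) → ℝ),
      IsNearlyIsometricCycle k D x → Represents p x →
      (Fintype.card (Fin (2 * k)) : ℝ)⁻¹ * ∑ b, entropy (p b) + κ ≤ entropy (mixture p))
    {n : ℕ} (h : EmbedsWithDistortion (points k n) (Ell1 (Fin d)) D) :
    n * κ ≤ Real.log (2 * d + 1) := by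
  obtain ⟨F, s, hs, hF⟩ := h
  let f : Vertex k n → Fin d → ℝ := fun v c => F ⟨WithLp.toLp 1 (label v), v, rfl⟩ c
  have hf : ∀ u v, s * labelDist u v ≤ ∑ c, |f u c - f v c| ∧
      ∑ c, |f u c - f v c| ≤ D * (s * labelDist u v) := fun u v => by
    have := hF ⟨WithLp.toLp 1 (label u), u, rfl⟩ ⟨WithLp.toLp 1 (label v), v, rfl⟩
    rwa [Subtype.dist_eq, dist_label, PiLp.dist_eq_of_L1] at this
  have hDs : 0 < D * s := mul_pos hD hs
  let y : Edge k n → Fin d → ℝ := fun e c =>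
    (D * s)⁻¹ * (f (endpoints e).2 c - f (endpoints e).1 c)
  have hy : ∀ e, ∑ c, |y e c| ≤ 1 := fun e => by
    have := (hf (endpoints e).2 (endpoints e).1).2
    rw [labelDist_comm, labelDist_endpoints, mul_one] at this
    simp only [y, abs_mul, abs_of_pos (inv_pos.2 hDs), ← Finset.mul_sum]
    rwa [inv_mul_le_iff₀ hDs, mul_one]
  let p : Edge k n → Option (Fin d × Bool) → ℝ := fun e a =>
    match a with
    | none => 1 - ∑ c, |y e c|
    | some (c, true) => max (y e c) 0
    | some (c, false) => max (-y e c) 0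
  have hp : ∀ e, p e ∈ stdSimplex ℝ (Option (Fin d × Bool)) := fun e => by
    refine ⟨?_, ?_⟩
    · rintro (_ | ⟨c, _ | _⟩)
      · exact sub_nonneg.2 (hy e)
      · exact le_max_right _ _
      · exact le_max_right _ _
    · rw [sum_option_prod_bool]
      have : ∀ c, p e (some (c, true)) + p e (some (c, false)) = |y e c| := fun c => by
        rcases le_total 0 (y e c) with h | h <;> simp [p, h, abs_of_nonneg, abs_of_nonpos]
      simp only [this]
      simp [p]
  have hpf : ∀ e c, p e (some (c, true)) - p e (some (c, false)) =
      (D * s)⁻¹ * (f (endpoints e).2 c - f (endpoints e).1 c) := fun e c => by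
    change max (y e c) 0 - max (-y e c) 0 = y e c
    rcases le_total 0 (y e c) with h | h <;> simp [h]
  have key := entropy_mixture_edges hk hD gain n f s hs hf p hp hpf
  have hne : Nonempty (Edge k n) := ⟨fun _ => ⟨0, by omega⟩⟩
  have h1 := entropy_le_log_card (mixture_mem_stdSimplex hp)
  have h2 : 0 ≤ (Fintype.card (Edge k n) : ℝ)⁻¹ * ∑ e, entropy (p e) :=
    mul_nonneg (by positivity) (Finset.sum_nonneg fun e _ => entropy_nonneg (hp e))
  have h3 : (Fintype.card (Option (Fin d × Bool)) : ℝ) = 2 * d + 1 := by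
    simp [mul_comm]
  rw [h3] at h1
  linarith

end RecursiveCycle

/-! ### Subsets of `L₁` -/

section L1

/-- `ℓ₁^ι` embeds isometrically into `L₁([0,1])`, as functions that are constant on disjoint
intervals. -/
theorem exists_isometry_L1Space (ι : Type) [Fintype ι] : ∃ J : Ell1 ι → L1Space, Isometry J := by
  let μ : Measure ℝ := volume.restrict (Set.Icc (0 : ℝ) 1)
  let g : ℕ → ℝ := fun m => ((m : ℝ) + 1)⁻¹
  have hg : Antitone g := fun a b hab => by
    have : (a : ℝ) ≤ b := by exact_mod_cast hab
    simp only [g]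
    gcongr
  let A : ι → Set ℝ := fun i =>
    Set.Ioc (g (Fintype.equivFin ι i + 1)) (g (Fintype.equivFin ι i))
  have hA : ∀ i, MeasurableSet (A i) := fun i => measurableSet_Ioc
  have hdisj : ∀ i j, i ≠ j → Disjoint (A i) (A j) := fun i j hij =>
    hg.pairwise_disjoint_on_Ioc_succ fun h =>
      hij ((Fintype.equivFin ι).injective (Fin.ext h))
  have hw : ∀ i, 0 < μ.real (A i) := fun i => by
    have hsub : A i ⊆ Set.Icc 0 1 := fun t ht => by
      refine ⟨le_trans (by positivity) ht.1.le, ht.2.trans ?_⟩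
      exact inv_le_one_of_one_le₀ (by simp)
    have hlt : g (Fintype.equivFin ι i + 1) < g (Fintype.equivFin ι i) := by
      simp only [g]
      push_cast
      gcongr
      linarith
    rw [measureReal_restrict_apply (hA i), Set.inter_eq_left.2 hsub, Real.volume_real_Ioc]
    exact lt_max_of_lt_left (sub_pos.2 hlt)
  let f : Ell1 ι → ℝ → ℝ := fun x t => ∑ i, (A i).indicator (fun _ => x i / μ.real (A i)) t
  have hind : ∀ (i : ι) (r : ℝ), Integrable ((A i).indicator fun _ => r) μ := fun i r =>
    (integrable_const r).indicator (hA i)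
  have hf : ∀ x, Integrable (f x) μ := fun x => integrable_finsetSum _ fun i _ => hind i _
  have hpt : ∀ x y t, dist (f x t) (f y t) =
      ∑ i, (A i).indicator (fun _ => dist (x i) (y i) / μ.real (A i)) t := by
    intro x y t
    by_cases ht : ∃ i, t ∈ A i
    · obtain ⟨i, hi⟩ := ht
      have hz : ∀ (h : ι → ℝ), ∑ j, (A j).indicator (fun _ => h j) t = h i := fun h => by
        rw [Finset.sum_eq_single i]
        · simp [hi]
        · intro j _ hj
          exact Set.indicator_of_notMem (fun hj' => (hdisj j i hj).le_bot ⟨hj', hi⟩) _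
        · simp
      simp only [f, hz]
      rw [Real.dist_eq, ← sub_div, abs_div, abs_of_pos (hw i), Real.dist_eq]
    · push Not at ht
      simp [f, ht]
  refine ⟨fun x => (hf x).toL1, Isometry.of_dist_eq fun x y => ?_⟩
  rw [L1.dist_eq_integral_dist]
  calc _ = ∫ t, dist (f x t) (f y t) ∂μ := by
        refine integral_congr_ae ?_
        filter_upwards [(hf x).coeFn_toL1, (hf y).coeFn_toL1] with t h1 h2
        rw [h1, h2]
    _ = ∑ i, dist (x i) (y i) := by
        simp only [hpt]
        rw [integral_finsetSum _ fun i _ => hind i _]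
        refine Finset.sum_congr rfl fun i _ => ?_
        rw [integral_indicator_const _ (hA i), smul_eq_mul, mul_div_cancel₀ _ (hw i).ne']
    _ = dist x y := (PiLp.dist_eq_of_L1 x y).symm

theorem EmbedsWithDistortion.of_isometry {X Z Y : Type*} [MetricSpace X] [MetricSpace Z]
    [MetricSpace Y] {J : X → Z} (hJ : Isometry J) {P : Set X} {S : Set Z} (hPS : J '' P ⊆ S)
    {D : ℝ} (h : EmbedsWithDistortion S Y D) : EmbedsWithDistortion P Y D := by
  obtain ⟨F, s, hs, hF⟩ := h
  refine ⟨fun x => F ⟨J x, hPS ⟨x, x.2, rfl⟩⟩, s, hs, fun x y => ?_⟩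
  have := hF ⟨J x, hPS ⟨x, x.2, rfl⟩⟩ ⟨J y, hPS ⟨y, y.2, rfl⟩⟩
  rwa [Subtype.dist_eq, hJ.dist_eq] at this

/-- A finite subset of `ℓ₁^ι` can be found inside subsets of `L₁` of any larger cardinality. -/
theorem exists_finset_L1Space {ι : Type} [Fintype ι] {P : Set (Ell1 ι)} (hP : P.Finite) {N : ℕ}
    (hN : P.ncard ≤ N) : ∃ S : Finset L1Space, S.card = N ∧
      ∀ (d : ℕ) (D : ℝ), EmbedsWithDistortion (S : Set L1Space) (Ell1 (Fin d)) D →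
        EmbedsWithDistortion P (Ell1 (Fin d)) D := by
  obtain ⟨J, hJ⟩ := exists_isometry_L1Space ι
  obtain ⟨J', hJ'⟩ := exists_isometry_L1Space Unit
  have : Infinite L1Space := by
    have hinj : Function.Injective fun r : ℝ => (WithLp.toLp 1 fun _ => r : Ell1 Unit) :=
      fun r s h => congrArg (fun x : Ell1 Unit => x ()) h
    exact Infinite.of_injective _ (hJ'.injective.comp hinj)
  have hfin : (J '' P).Finite := hP.image J
  have hcard : hfin.toFinset.card ≤ N := by
    rw [← Set.ncard_eq_toFinset_card _ hfin]
    exact (Set.ncard_image_le hP).trans hN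
  obtain ⟨S, hS, hSN⟩ := Infinite.exists_superset_card_eq hfin.toFinset N hcard
  refine ⟨S, hSN, fun d D h => h.of_isometry hJ fun z hz => hS ?_⟩
  simpa using hz

end L1

/-! ### Dimension bounds -/

section Bounds

open Real

theorem exists_pow_le_le_pow {m : ℕ} (hm : 2 ≤ m) {n₀ N : ℕ} (h : 2 * m ^ n₀ ≤ N) :
    ∃ n, n₀ ≤ n ∧ 2 * m ^ n ≤ N ∧ N ≤ 2 * m ^ (n + 1) := by
  have hm0 : 0 < m ^ n₀ := by positivity
  have h1 : m ^ n₀ ≤ N / 2 := by omega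
  have h2 := Nat.pow_log_le_self m (show N / 2 ≠ 0 by omega)
  have h3 := Nat.lt_pow_succ_log_self (show 1 < m by omega) (N / 2)
  refine ⟨Nat.log m (N / 2), Nat.le_log_of_pow_le (by omega) h1, by omega, ?_⟩
  rw [Nat.succ_eq_add_one] at h3
  omega

theorem rpow_le_of_log_le {x y z : ℝ} (hx : 0 ≤ x) (hy : 0 < y) (hz : 1 ≤ z)
    (h : 1 ≤ x → y * log x ≤ log z) : x ^ y ≤ z := by
  rcases lt_or_ge x 1 with hx1 | hx1
  · exact (rpow_le_one hx hx1.le hy.le).trans hz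
  · exact (rpow_le_iff_le_log (by linarith) (by linarith)).2 (h hx1)

theorem rpow_le_max_of_embedsWithDistortion {n N d : ℕ} {D : ℝ} (hn : 1 ≤ n) (hD : 1 < D)
    (hN : N ≤ 2 * (2 * 2) ^ (n + 1))
    (h : EmbedsWithDistortion (RecursiveCycle.points 2 n) (Ell1 (Fin d)) D) :
    (N : ℝ) ^ (1 / 96 / D ^ 2) ≤ max (d : ℝ) 2 := by
  have hD0 : 0 < D := by linarith
  have key := RecursiveCycle.mul_le_log_of_embedsWithDistortion (by norm_num) hD0
    (fun x p hx hp => entropy_gain_four_cycle hD0 hx hp) h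
  have hm2 : (2 : ℝ) ≤ max (d : ℝ) 2 := le_max_right _ _
  have hlog : log (2 * d + 1) ≤ 3 * log (max (d : ℝ) 2) := by
    rw [← log_rpow (by positivity), show (3 : ℝ) = ((3 : ℕ) : ℝ) by norm_num, rpow_natCast]
    refine log_le_log (by positivity) ?_
    have hmd : (d : ℝ) ≤ max (d : ℝ) 2 := le_max_left _ _
    nlinarith [mul_nonneg (sub_nonneg.2 hm2) (sub_nonneg.2 hm2)]
  refine rpow_le_of_log_le (by positivity) (by positivity) (by linarith) fun hN1 => ?_
  have hn' : (1 : ℝ) ≤ n := by exact_mod_cast hn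
  have hlogN : log N ≤ 4 * n := by
    calc log N ≤ log (2 * (2 * 2) ^ (n + 1)) := log_le_log (by linarith) (by exact_mod_cast hN)
      _ = log (2 ^ (2 * n + 3)) := by
          congr 1
          rw [show (2 * 2 : ℝ) = 2 ^ 2 by norm_num, ← pow_mul]
          ring
      _ = (2 * n + 3) * log 2 := by rw [log_pow]; push_cast; ring
      _ ≤ (2 * n + 3) * 0.7 := by
          gcongr
          exact log_two_lt_d9.le.trans (by norm_num)
      _ ≤ 4 * n := by linarith
  calc 1 / 96 / D ^ 2 * log N ≤ 1 / 96 / D ^ 2 * (4 * n) := by gcongr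
    _ = n * (1 / (8 * D ^ 2)) / 3 := by field_simp; norm_num
    _ ≤ log (max (d : ℝ) 2) := by linarith

theorem one_le_of_log_pos {d : ℕ} (h : 0 < log (2 * d + 1)) : 1 ≤ d := by
  by_contra hd
  obtain rfl : d = 0 := by omega
  simp at h

/-- For `ε < exp (-40)` the cycles are chosen of length about `ε ^ (-1/4)`; for larger `ε` the
exponent is not positive. -/
theorem exists_forall_rpow_le {ε : ℝ} (hε0 : 0 < ε) (hε1 : ε < 1) :
    ∃ k : ℕ, 2 ≤ k ∧ ∃ n₀ : ℕ, ∀ n : ℕ, n₀ ≤ n → ∀ N : ℕ, N ≤ 2 * (2 * k) ^ (n + 1) → ∀ d : ℕ,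
      EmbedsWithDistortion (RecursiveCycle.points k n) (Ell1 (Fin d)) (1 + ε) →
        (N : ℝ) ^ (1 - 40 / log (1 / ε)) ≤ (d : ℝ) := by
  set L := log (1 / ε) with hL
  have hL0 : 0 < L := log_pos (by rw [lt_div_iff₀ hε0]; linarith)
  have hεL : ε = exp (-L) := by rw [hL, one_div, log_inv, neg_neg, exp_log hε0]
  rcases le_or_gt L 40 with hL40 | hL40
  · refine ⟨2, le_rfl, 1, fun n hn N _ d h => ?_⟩
    have key := RecursiveCycle.mul_le_log_of_embedsWithDistortion (by norm_num)
      (show 0 < 1 + ε by linarith)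
      (fun x p hx hp => entropy_gain_four_cycle (by linarith) hx hp) h
    have hn' : (0 : ℝ) < n := by exact_mod_cast hn
    have hd : (1 : ℝ) ≤ d := by
      exact_mod_cast one_le_of_log_pos (lt_of_lt_of_le (by positivity) key)
    refine le_trans ?_ hd
    have hexp : 1 - 40 / L ≤ 0 := by
      rw [sub_nonpos, le_div_iff₀ hL0]; linarith
    rcases Nat.eq_zero_or_pos N with rfl | hN
    · simpa using zero_rpow_le_one (1 - 40 / L)
    · exact rpow_le_one_of_one_le_of_nonpos (by exact_mod_cast hN) hexp
  · set k := ⌊exp (L / 4)⌋₊ with hk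
    have hE : 2 ≤ exp (L / 4) := by linarith [add_one_le_exp (L / 4)]
    have hk2 : 2 ≤ k := Nat.le_floor (by exact_mod_cast hE)
    have hkle : (k : ℝ) ≤ exp (L / 4) := Nat.floor_le (exp_pos _).le
    have hkge : exp (L / 4) ≤ 2 * k := by
      have h1 := Nat.lt_floor_add_one (exp (L / 4))
      have h2 : (2 : ℝ) ≤ k := by exact_mod_cast hk2
      linarith
    have hkε : (k : ℝ) ^ 4 * ε ≤ 1 := by
      calc (k : ℝ) ^ 4 * ε ≤ exp (L / 4) ^ 4 * ε := by gcongr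
        _ = 1 := by
          rw [hεL, ← exp_nat_mul, ← exp_add, exp_eq_one_iff]
          push_cast
          ring
    have hk0 : (0 : ℝ) < k := by exact_mod_cast (by omega : 0 < k)
    have hlogk : L / 4 ≤ log (2 * k) := by
      rw [le_log_iff_exp_le (by positivity)]; exact hkge
    refine ⟨k, hk2, ⌈log (2 * k) + log 2 + log 3⌉₊ + 1, fun n hn N hN d h => ?_⟩
    have key := RecursiveCycle.mul_le_log_of_embedsWithDistortion (by omega)
      (show 0 < 1 + ε by linarith)
      (fun x p hx hp => entropy_gain_two_mul_cycle hε0 hk2 hkε hx hp) h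
    have hn1 : log (2 * k) + log 2 + log 3 ≤ n :=
      (Nat.le_ceil _).trans (Nat.cast_le.2 (by omega))
    have hn' : (0 : ℝ) < n := by exact_mod_cast (by omega : 0 < n)
    have hd : (1 : ℝ) ≤ d := by
      exact_mod_cast one_le_of_log_pos
        (lt_of_lt_of_le (mul_pos hn' (by linarith)) key)
    have hlogd : log (2 * d + 1) ≤ log 3 + log d := by
      rw [← log_mul (by norm_num) (by linarith)]
      exact log_le_log (by positivity) (by linarith)
    have hexp : 0 < 1 - 40 / L := by
      rw [sub_pos, div_lt_one hL0]; exact hL40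
    refine rpow_le_of_log_le (by positivity) hexp hd fun hN1 => ?_
    have hlogN : log N ≤ (n + 1) * log (2 * k) + log 2 := by
      calc log N ≤ log (2 * (2 * k) ^ (n + 1)) := log_le_log (by linarith) (by exact_mod_cast hN)
        _ = (n + 1) * log (2 * k) + log 2 := by
          rw [log_mul (by norm_num) (by positivity), log_pow]
          push_cast
          ring
    have hlog2 : 0 ≤ log 2 := log_nonneg (by norm_num)
    have h10 : 10 ≤ 40 / L * log (2 * k) := by
      calc (10 : ℝ) = 40 / L * (L / 4) := by field_simp; norm_num
        _ ≤ 40 / L * log (2 * k) := by gcongr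
    have h11 : 0 ≤ 40 / L * log 2 := by positivity
    calc (1 - 40 / L) * log N ≤ (1 - 40 / L) * ((n + 1) * log (2 * k) + log 2) := by gcongr
      _ = (n + 1) * log (2 * k) + log 2 - (n + 1) * (40 / L * log (2 * k)) - 40 / L * log 2 := by
        ring
      _ ≤ (n + 1) * log (2 * k) + log 2 - (n + 1) * 10 := by
        have := mul_le_mul_of_nonneg_left h10 (show (0 : ℝ) ≤ n + 1 by positivity)
        linarith
      _ ≤ log d := by linarith

end Bounds

theorem theorem1 :
    (∃ c : ℝ, 0 < c ∧
      (∃ N₀ : ℕ, ∀ N : ℕ, N₀ ≤ N →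
        ∃ S : Finset L1Space, S.card = N ∧
          ∀ D : ℝ, 1 < D → ∀ d : ℕ,
            EmbedsWithDistortion (S : Set L1Space) (Ell1 (Fin d)) D →
              (N : ℝ) ^ (c / D ^ 2) ≤ max (d : ℝ) 2) ∧
      (∀ n : ℕ, 1 ≤ n → ∀ D : ℝ, 1 < D → ∀ d : ℕ,
        EmbedsWithDistortion (RecursiveCycle.points 2 n) (Ell1 (Fin d)) D →
          ((RecursiveCycle.points 2 n).ncard : ℝ) ^ (c / D ^ 2) ≤ max (d : ℝ) 2)) ∧
    (∃ C : ℝ, 0 < C ∧ ∀ ε : ℝ, 0 < ε → ε < 1 →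
      (∃ N₀ : ℕ, ∀ N : ℕ, N₀ ≤ N →
        ∃ S : Finset L1Space, S.card = N ∧
          ∀ d : ℕ,
            EmbedsWithDistortion (S : Set L1Space) (Ell1 (Fin d)) (1 + ε) →
              (N : ℝ) ^ (1 - C / Real.log (1 / ε)) ≤ (d : ℝ)) ∧
      (∃ k : ℕ, 2 ≤ k ∧ ∃ n₀ : ℕ, ∀ n : ℕ, n₀ ≤ n → ∀ d : ℕ,
        EmbedsWithDistortion (RecursiveCycle.points k n) (Ell1 (Fin d)) (1 + ε) →
          ((RecursiveCycle.points k n).ncard : ℝ) ^ (1 - C / Real.log (1 / ε)) ≤ (d : ℝ))) := by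
  have hcard : ∀ k n : ℕ, 2 ≤ k →
      (RecursiveCycle.points k n).ncard ≤ 2 * (2 * k) ^ (n + 1) := fun k n hk =>
    (RecursiveCycle.ncard_points_le (by omega) n).trans
      (Nat.mul_le_mul_left 2 (Nat.pow_le_pow_right (by omega) n.le_succ))
  -- For every large `N`, an `N`-point superset of `P_{k,n}` with `n` as large as possible.
  have hsup : ∀ k n₀ N : ℕ, 2 ≤ k → 2 * (2 * k) ^ n₀ ≤ N → ∃ n, n₀ ≤ n ∧
      N ≤ 2 * (2 * k) ^ (n + 1) ∧ ∃ S : Finset L1Space, S.card = N ∧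
      ∀ (d : ℕ) (D : ℝ), EmbedsWithDistortion (S : Set L1Space) (Ell1 (Fin d)) D →
        EmbedsWithDistortion (RecursiveCycle.points k n) (Ell1 (Fin d)) D := by
    intro k n₀ N hk hN
    obtain ⟨n, hn, h1, h2⟩ := exists_pow_le_le_pow (by omega) hN
    exact ⟨n, hn, h2, exists_finset_L1Space (RecursiveCycle.points_finite k n)
      ((RecursiveCycle.ncard_points_le (by omega) n).trans h1)⟩
  refine ⟨⟨1 / 96, by norm_num, ⟨2 * (2 * 2) ^ 1, fun N hN => ?_⟩, fun n hn D hD d h =>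
      rpow_le_max_of_embedsWithDistortion hn hD (hcard 2 n le_rfl) h⟩,
    40, by norm_num, fun ε hε0 hε1 => ?_⟩
  · obtain ⟨n, hn, hle, S, hS, hemb⟩ := hsup 2 1 N le_rfl hN
    exact ⟨S, hS, fun D hD d h =>
      rpow_le_max_of_embedsWithDistortion hn hD hle (hemb d D h)⟩
  · obtain ⟨k, hk, n₀, hbound⟩ := exists_forall_rpow_le hε0 hε1
    refine ⟨⟨2 * (2 * k) ^ n₀, fun N hN => ?_⟩,
      k, hk, n₀, fun n hn d h => hbound n hn _ (hcard k n hk) d h⟩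
    obtain ⟨n, hn, hle, S, hS, hemb⟩ := hsup k n₀ N hk hN
    exact ⟨S, hS, fun d h => hbound n hn N hle d (hemb d _ h)⟩
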